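/- Setting. Let $(E,\mathcal E)$ be a measurable space with a finite nonzero measure $du$. For $l\ge 0$ let $\kappa_l:E\to(0,\infty)$ be measurable and integrable, $Z_l=\int\kappa_l(u)\,du$ and $\eta_l(du)=\frac{\kappa_l(u)}{Z_l}\,du$. Let also $\kappa_\infty\ge 0$ be measurable and integrable with $Z_\infty=\int\kappa_\infty(u)\,du>0$. Put $G_l=\kappa_{l+1}/\kappa_l$, and for $l\ge1$ let $M_l$ be a Markov kernel with $\eta_lM_l=\eta_l$. Let $\gamma_0=\eta_0$ and $$\gamma_l(du_l)=\int_{E^l}\Big(\prod_{p=0}^{l-1}G_p(u_p)\Big)\eta_0(du_0)\prod_{p=1}^{l}M_p(u_{p-1},du_p)\quad(l\ge1),$$ so that $\gamma_l(1)=Z_l/Z_0$, and put $\gamma_\infty(1)=Z_\infty/Z_0$. The accuracy parameters are $h_l=h_0M^{-l}$ with $h_0>0$ and $M>1$. Write $\mathrm C(G_l)\ge 0$ for the cost of one evaluation of $G_l$, and $\|f\|_\infty=\sup_{u\in E}|f(u)|$. SMC algorithm. Given particle numbers $N_0\ge N_1\ge\cdots\ge1$, sample $U_0^1,\dots,U_0^{N_0}$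 i.i.d. from $\eta_0$; given the particles $U_l^{1:N_l}$ of level $l$, sample $U_{l+1}^{1},\dots,U_{l+1}^{N_{l+1}}$ independently from $$\frac{\sum_{i=1}^{N_l}G_l(U_l^i)\,M_{l+1}(U_l^i,\cdot)}{\sum_{i=1}^{N_l}G_l(U_l^i)}.$$ $\mathbb E$ is the expectation for the law of this algorithm. Let $\eta_l^{N_l}(f)=\frac1{N_l}\sum_{i=1}^{N_l}f(U_l^i)$ and $\gamma_q^{N_{0:q}}(f)=\big(\prod_{k=0}^{q-1}\eta_k^{N_k}(G_k)\big)\eta_q^{N_q}(f)$. For $L\ge2$ the new estimator is $$\tilde\gamma_L(1)=\eta_0^{N_0}(G_0)+\sum_{p=2}^{L}\gamma_{p-2}^{N_{0:p-2}}\big(G_{p-2}(G_{p-1}-1)\big).$$ Let $$\mathrm{COST}=\sum_{l=0}^{L}N_l\,\mathrm C(G_l)+\sum_{l=0}^{L-2}N_l\,\mathrm C(G_{l+1}),$$ where the first sum is the cost of the sampler and the second is the cost of the further evaluations that the estimator needs. Assumptions. (A1) There are $0<\underline C<\overline C<\infty$ with $\underline C\le\kappa_l(u)\le\overline C$ for all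 $0\le l<\infty$ and $u\in E$. (A2) There is $\rho\in(0,1)$ with $M_l(u,A)\ge\rho\,M_l(v,A)$ for all $l\ge1$, $u,v\in E$, $A\in\mathcal E$. (A3)(i) For some $\alpha,\zeta>0$ there is $C>0$ such that for all $p\ge1$: $\big|\frac{\gamma_p(1)}{\gamma_\infty(1)}-1\big|\le Ch_p^{\alpha}$ and $\mathrm C(G_{p-1})\le Ch_p^{-\zeta}$. (A3)(iii) For some $\beta>0$ there is $C>0$ such that $\|G_{p-1}-1\|_\infty^2\le Ch_p^{\beta}$ for all $p\ge1$. Theorem. Assume (A1), (A2), (A3)(i) and (A3)(iii) with $2\alpha\ge\max\{\beta,\zeta\}$, and let $0<\varepsilon_0<1$. Then there is a constant $C>0$, independent of $\varepsilon$, such that for every $0<\varepsilon\le\varepsilon_0$ there exist $L\ge2$ and particle numbers $N_0\ge N_1\ge\cdots\ge1$ such that $$\frac{1}{\gamma_\infty(1)^2}\,\mathbb E\Big[\big(\tilde\gamma_L(1)-\gamma_\infty(1)\big)^2\Big]\le C\varepsilon^2$$ (the expectation being finite) and $$\mathrm{COST}\le C\begin{cases}\varepsilon^{-2}|\log\varepsilon|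 & \text{if }\beta>\zeta,\\ \varepsilon^{-2}|\log\varepsilon|^3 & \text{if }\beta=\zeta,\\ \varepsilon^{-(2+\frac{\zeta-\beta}{\alpha})}|\log\varepsilon| & \text{if }\beta<\zeta.\end{cases}$$ -/

import Mathlib

open MeasureTheory ProbabilityTheory Filter Topology

namespace MLSMC

variable {E : Type*} [MeasurableSpace E]

/-- The normalising constant `Z = ∫ κ(u) du` of an unnormalised density `κ`. -/
noncomputable def partitionFn (base : Measure E) (k : E → ℝ) : ℝ := ∫ u, k u ∂base

/-- The measure `(κ(u) / Z) du`. -/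
noncomputable def targetMeasure (base : Measure E) (k : E → ℝ) : Measure E :=
  base.withDensity fun u => ENNReal.ofReal (k u / partitionFn base k)

/-- The data of the multilevel problem: a finite dominating measure `du`, the strictly positive
unnormalised densities `κ_l` of the targets `η_l`, the unnormalised density `κ_∞` of the limiting
target, and the Markov kernels `M_l`, where `M_l` leaves `η_l` invariant for `l ≥ 1`.
(`M_0` is never used.) -/
structure Model (E : Type*) [MeasurableSpace E] where
  /-- the dominating measure `du` -/
  base : Measure E
  finite_base : IsFiniteMeasure base
  base_ne_zero : base ≠ 0
  /-- the unnormalised densities `κ_l` -/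
  kappa : ℕ → E → ℝ
  kappa_pos : ∀ l u, 0 < kappa l u
  kappa_measurable : ∀ l, Measurable (kappa l)
  kappa_integrable : ∀ l, Integrable (kappa l) base
  /-- the unnormalised density `κ_∞` -/
  kappaInf : E → ℝ
  kappaInf_nonneg : ∀ u, 0 ≤ kappaInf u
  kappaInf_measurable : Measurable kappaInf
  kappaInf_integrable : Integrable kappaInf base
  partitionFn_kappaInf_pos : 0 < partitionFn base kappaInf
  /-- the Markov kernels `M_l` -/
  M : ℕ → Kernel E E
  markov : ∀ l, IsMarkovKernel (M l)
  invariant : ∀ l, 1 ≤ l →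
    (targetMeasure base (kappa l)).bind (M l) = targetMeasure base (kappa l)

namespace Model

variable (m : Model E)

/-- The normalising constant `Z_l`. -/
noncomputable def Z (l : ℕ) : ℝ := partitionFn m.base (m.kappa l)

/-- The normalising constant `Z_∞`. -/
noncomputable def ZInf : ℝ := partitionFn m.base m.kappaInf

/-- The target probability measure `η_l(du) = κ_l(u) / Z_l du`. -/
noncomputable def eta (l : ℕ) : Measure E := targetMeasure m.base (m.kappa l)

/-- The incremental weight `G_l = κ_{l+1} / κ_l`. -/
noncomputable def G (l : ℕ) (u : E) : ℝ := m.kappa (l + 1) u / m.kappa l u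

/-- The unnormalised Feynman-Kac measure
`γ_l(du_l) = ∫ (∏_{p<l} G_p(u_p)) η_0(du_0) ∏_{p=1}^l M_p(u_{p-1}, du_p)`, written recursively. -/
noncomputable def gamma : ℕ → Measure E
  | 0 => m.eta 0
  | l + 1 => ((gamma l).withDensity fun u => ENNReal.ofReal (m.G l u)).bind (m.M (l + 1))

/-- `γ_l(1)`. -/
noncomputable def gammaOne (l : ℕ) : ℝ := (m.gamma l).real Set.univ

/-- `γ_∞(1) = Z_∞ / Z_0`. -/
noncomputable def gammaInf : ℝ := m.ZInf / m.Z 0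

/-! ### The particle system -/

lemma G_pos (l : ℕ) (u : E) : 0 < m.G l u := div_pos (m.kappa_pos _ _) (m.kappa_pos _ _)

lemma measurable_G (l : ℕ) : Measurable (m.G l) :=
  (m.kappa_measurable _).div (m.kappa_measurable _)

lemma Z_pos (l : ℕ) : 0 < m.Z l := by
  have := m.finite_base
  have hne := m.base_ne_zero
  refine (integral_pos_iff_support_of_nonneg (fun u => (m.kappa_pos l u).le)
    (m.kappa_integrable l)).2 ?_
  have : Function.support (m.kappa l) = Set.univ := by
    ext u; simp [(m.kappa_pos l u).ne']
  rw [this]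
  exact Measure.measure_univ_pos.2 hne

instance isProbabilityMeasure_eta (l : ℕ) : IsProbabilityMeasure (m.eta l) := by
  refine ⟨?_⟩
  have hZ := m.Z_pos l
  change 0 < partitionFn m.base (m.kappa l) at hZ
  rw [eta, targetMeasure, withDensity_apply _ MeasurableSet.univ, Measure.restrict_univ,
    ← ofReal_integral_eq_lintegral_ofReal ((m.kappa_integrable l).div_const _)
      (ae_of_all _ fun u => div_nonneg (m.kappa_pos l u).le hZ.le), integral_div]
  change ENNReal.ofReal (partitionFn m.base (m.kappa l) / partitionFn m.base (m.kappa l)) = 1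
  rw [div_self hZ.ne', ENNReal.ofReal_one]

/-- The conditional law of one particle at level `l + 1` given the particles `u` at level `l`
(multinomial resampling with weights `G_l`, then a move by `M_{l+1}`):
`(∑_i G_l(u^i) M_{l+1}(u^i, ·)) / ∑_i G_l(u^i)`. -/
noncomputable def particleLaw (l : ℕ) {n : ℕ} (u : Fin n → E) : Measure E :=
  (∑ i, ENNReal.ofReal (m.G l (u i)))⁻¹ •
    ∑ i, ENNReal.ofReal (m.G l (u i)) • m.M (l + 1) (u i)

lemma particleLaw_apply (l : ℕ) {n : ℕ} (u : Fin n → E) (s : Set E) :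
    m.particleLaw l u s = (∑ i, ENNReal.ofReal (m.G l (u i)))⁻¹ *
      ∑ i, ENNReal.ofReal (m.G l (u i)) * m.M (l + 1) (u i) s := by
  simp [particleLaw]

lemma isProbabilityMeasure_particleLaw (l : ℕ) {n : ℕ} (hn : 0 < n) (u : Fin n → E) :
    IsProbabilityMeasure (m.particleLaw l u) := by
  have := m.markov
  refine ⟨?_⟩
  rw [particleLaw_apply]
  simp only [measure_univ, mul_one]
  refine ENNReal.inv_mul_cancel (fun h => ?_) ?_
  · rw [Finset.sum_eq_zero_iff] at h
    have := h ⟨0, hn⟩ (Finset.mem_univ _)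
    exact absurd (ENNReal.ofReal_eq_zero.1 this) (not_le.2 (m.G_pos _ _))
  · exact ENNReal.sum_ne_top.2 fun _ _ => ENNReal.ofReal_ne_top

lemma measurable_particleLaw (l n : ℕ) :
    Measurable fun u : Fin n → E => m.particleLaw l u := by
  refine Measure.measurable_of_measurable_coe _ fun s hs => ?_
  simp only [particleLaw_apply]
  have hG : ∀ i : Fin n, Measurable fun u : Fin n → E => ENNReal.ofReal (m.G l (u i)) :=
    fun i => ((m.measurable_G l).comp (measurable_pi_apply i)).ennreal_ofReal
  have hM : ∀ i : Fin n, Measurable fun u : Fin n → E => m.M (l + 1) (u i) s :=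
    fun i => ((m.M (l + 1)).measurable_coe hs).comp (measurable_pi_apply i)
  exact (Finset.measurable_sum _ fun i _ => hG i).inv.mul
    (Finset.measurable_sum _ fun i _ => (hG i).mul (hM i))

/-- The transition from the `n` particles at level `l` to the `k` particles at level `l + 1`:
given the former, the latter are independent with law `particleLaw`. -/
noncomputable def stepKernel (l : ℕ) (n k : ℕ+) : Kernel (Fin n → E) (Fin k → E) where
  toFun u := Measure.pi fun _ => m.particleLaw l u
  measurable' := by
    have hp : ∀ u : Fin n → E, IsProbabilityMeasure (m.particleLaw l u) :=
      m.isProbabilityMeasure_particleLaw l n.pos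
    refine Measurable.measure_of_isPiSystem_of_isProbabilityMeasure generateFrom_pi.symm
      isPiSystem_pi ?_
    rintro _ ⟨s, hs, rfl⟩
    simp only [Measure.pi_pi]
    exact Finset.measurable_prod _ fun i _ =>
      (Measure.measurable_coe (hs i (Set.mem_univ i))).comp (m.measurable_particleLaw l n)

instance isMarkovKernel_stepKernel (l : ℕ) (n k : ℕ+) : IsMarkovKernel (m.stepKernel l n k) :=
  ⟨fun u => by
    have := m.isProbabilityMeasure_particleLaw l n.pos u
    change IsProbabilityMeasure (Measure.pi fun _ => m.particleLaw l u)
    infer_instance⟩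

/-- The step kernels, viewed as depending on the whole past (through the current level only). -/
noncomputable def historyKernel (N : ℕ → ℕ+) (l : ℕ) :
    Kernel ((i : Finset.Iic l) → (Fin (N i) → E)) (Fin (N (l + 1)) → E) :=
  (m.stepKernel l (N l) (N (l + 1))).comap (fun x => x ⟨l, Finset.mem_Iic.2 le_rfl⟩)
    (measurable_pi_apply _)

instance isMarkovKernel_historyKernel (N : ℕ → ℕ+) (l : ℕ) :
    IsMarkovKernel (m.historyKernel N l) := by
  unfold historyKernel; infer_instance

/-- The law of the SMC algorithm with `N_l` particles at level `l`: the particles at level `0` are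
i.i.d. from `η_0`, and level `l + 1` is drawn from level `l` by `stepKernel`. A point of the path
space is `x` with `x l i = U_l^i`. -/
noncomputable def smcLaw (N : ℕ → ℕ+) : Measure ((l : ℕ) → Fin (N l) → E) :=
  Kernel.trajMeasure (X := fun l => Fin (N l) → E) (Measure.pi fun _ => m.eta 0)
    (m.historyKernel N)

/-- The empirical mean `η_l^{N_l}(f) = (1 / N_l) ∑_i f(U_l^i)`. -/
noncomputable def etaN {N : ℕ → ℕ+} (x : (l : ℕ) → Fin (N l) → E) (l : ℕ) (f : E → ℝ) : ℝ :=
  (1 / (N l : ℝ)) * ∑ i, f (x l i)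

/-- `γ_q^{N_{0:q}}(f) = (∏_{k<q} η_k^{N_k}(G_k)) η_q^{N_q}(f)`. -/
noncomputable def gammaN {N : ℕ → ℕ+} (x : (l : ℕ) → Fin (N l) → E) (q : ℕ) (f : E → ℝ) : ℝ :=
  (∏ k ∈ Finset.range q, etaN x k (m.G k)) * etaN x q f

/-- The new estimator
`γ̃_l^{N_{0:l-2}}(1) = η_0^{N_0}(G_0) + ∑_{p=2}^l γ_{p-2}^{N_{0:p-2}}(G_{p-2} (G_{p-1} - 1))`. -/
noncomputable def newEstimator {N : ℕ → ℕ+} (l : ℕ) (x : (l : ℕ) → Fin (N l) → E) : ℝ :=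
  etaN x 0 (m.G 0) +
    ∑ p ∈ Finset.Icc 2 l, m.gammaN x (p - 2) fun u => m.G (p - 2) u * (m.G (p - 1) u - 1)

/-! ### The assumptions -/

/-- The `κ_l` are bounded above and away from zero, uniformly in `l` and `u`. -/
def BoundedDensities : Prop :=
  ∃ cLow cUp : ℝ, 0 < cLow ∧ cLow < cUp ∧ ∀ l u, cLow ≤ m.kappa l u ∧ m.kappa l u ≤ cUp

/-- The kernels `M_l`, `l ≥ 1`, are uniformly mixing. -/
def UniformMixing : Prop :=
  ∃ ρ : ℝ, 0 < ρ ∧ ρ < 1 ∧ ∀ l, 1 ≤ l → ∀ u v : E, ∀ A : Set E, MeasurableSet A →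
    ρ * (m.M l v).real A ≤ (m.M l u).real A

/-- The bias rate `α` and the cost rate `ζ`; `cost l` is the cost of one evaluation of `G_l`. -/
def BiasCostRate (h cost : ℕ → ℝ) (α ζ : ℝ) : Prop :=
  ∃ C : ℝ, 0 < C ∧ ∀ p, 1 ≤ p →
    |m.gammaOne p / m.gammaInf - 1| ≤ C * h p ^ α ∧ cost (p - 1) ≤ C * h p ^ (-ζ)

/-- The rate `β`: `‖G_{p-1} - 1‖_∞² ≤ C h_p^β` for all `p ≥ 1`. -/
def WeightRate (h : ℕ → ℝ) (β : ℝ) : Prop :=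
  ∃ C : ℝ, 0 < C ∧ ∀ p, 1 ≤ p → (⨆ u, |m.G (p - 1) u - 1|) ^ 2 ≤ C * h p ^ β

end Model

/-- The computational cost: the SMC algorithm evaluates `G_l` at each of the `N_l` particles of
level `l ≤ L`, at the cost `∑_{l ≤ L} N_l C(G_l)`, and the new estimator needs in addition the
values of `G_{l+1}` at the particles of level `l ≤ L - 2`. -/
noncomputable def totalCost (cost : ℕ → ℝ) (N : ℕ → ℕ+) (L : ℕ) : ℝ :=
  ∑ l ∈ Finset.range (L + 1), (N l : ℝ) * cost l +
    ∑ l ∈ Finset.range (L - 1), (N l : ℝ) * cost (l + 1)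

end MLSMC

/-!
The estimator is `∑_{q ≤ L-2} γ_q^N(f_q)` with `f_0 = G_0 G_1` and `f_q = G_q (G_{q+1} - 1)` for
`q ≥ 1` (`newEstimator_eq_sum`). Because `M_l` leaves `η_l` invariant, `γ_l = (Z_l / Z_0) η_l`
(`gamma_eq`), so that `γ_q(f_q) = γ_{q+2}(1) - γ_{q+1}(1)` for `q ≥ 1` and the sum of the exact
values `γ_q(f_q)` telescopes to `γ_L(1)`.

Let `V_k` be the value function of the terms from level `k` on, defined by the backward recursion
`V_k = f_k + G_k M_{k+1}(V_{k+1})`. Given level `k`, the particles of level `k + 1` are independent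
with a law under which, after multiplication by `η_k^N(G_k)`, the mean of `V_{k+1}` is
`η_k^N(G_k M_{k+1} V_{k+1})`. Hence `∑_{j<k} γ_j^N(f_j) + γ_k^N(V_k)` is a martingale that starts
with mean `η_0(V_0) = γ_L(1)` and ends at the estimator. Its increments are orthogonal, and the one of
level `k` has second moment at most `W² ‖V_k‖² / N_k`, with `W` a bound for the products
`∏_{j<k} η_j^N(G_j)` (`integral_sq_partialSum_sub_le`).

Since `‖G_l - 1‖ ≤ c r^l` with `r = b^{-β/2} < 1`, the products of weights are bounded
(`abs_prod_etaN_le`) and `‖V_k‖` is of order `r^k` (`abs_valueFn_le`). The variance is therefore of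
order `∑_k b^{-βk} / N_k`, as for a multilevel Monte Carlo sum of independent terms
(`exists_mse_le`). The level `L` with `b^{-αL} ≈ ε` controls the bias, and the allocation
`N_l ∝ b^{-l(β+ζ)/2}`, for which variance and cost per level are both proportional to
`b^{l(ζ-β)/2}`, gives the cost `ε⁻² (∑_{l≤L} b^{l(ζ-β)/2})²` (`exists_allocation`), whose size is
decided by the sign of `ζ - β` (`exists_sq_geom_sum_le`). Rounding the `N_l` up costs
`∑_{l≤L} b^{ζl} = O(ε^{-ζ/α})`, which is `O(ε⁻²)` because `ζ ≤ 2α`.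
-/

/-! ### Empirical means of independent samples -/

namespace MLSMC

variable {E : Type*} [MeasurableSpace E]

omit [MeasurableSpace E] in
lemma abs_mean_le {n : ℕ+} {F : E → ℝ} {B : ℝ} (hB : ∀ u, |F u| ≤ B) (z : Fin n → E) :
    |(1 / (n : ℝ)) * ∑ i, F (z i)| ≤ B := by
  have hn : (0 : ℝ) < n := by exact_mod_cast n.pos
  rw [abs_mul, abs_of_pos (by positivity), one_div, inv_mul_le_iff₀ hn]
  calc |∑ i, F (z i)| ≤ ∑ i, |F (z i)| := Finset.abs_sum_le_sum_abs _ _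
    _ ≤ ∑ _i : Fin n, B := Finset.sum_le_sum fun i _ => hB _
    _ = n * B := by simp

lemma measurable_mean (n : ℕ+) {F : E → ℝ} (hF : Measurable F) :
    Measurable fun z : Fin n → E => (1 / (n : ℝ)) * ∑ i, F (z i) := by
  fun_prop

lemma integrable_of_abs_le {Ω : Type*} [MeasurableSpace Ω] {P : Measure Ω} [IsFiniteMeasure P]
    {F : Ω → ℝ} (hF : Measurable F) {B : ℝ} (hB : ∀ u, |F u| ≤ B) : Integrable F P :=
  Integrable.of_bound hF.aestronglyMeasurable B (ae_of_all _ fun u => by simpa using hB u)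

lemma abs_integral_le {P : Measure E} [IsProbabilityMeasure P]
    {F : E → ℝ} {B : ℝ} (hB : ∀ u, |F u| ≤ B) : |∫ u, F u ∂P| ≤ B := by
  rw [← Real.norm_eq_abs]
  simpa using norm_integral_le_of_norm_le_const (μ := P) (f := F) (C := B)
    (ae_of_all _ fun u => by simpa using hB u)

/-- The empirical mean is centred and has variance at most `B² / n`, so that an affine function of
it with constant term `a` has second moment at most `a² + w² B² / n`. -/
lemma integral_sq_add_mul_mean_sub_le {ν : Measure E} [IsProbabilityMeasure ν] (n : ℕ+)
    {F : E → ℝ} (hF : Measurable F) {B : ℝ} (hB : ∀ u, |F u| ≤ B) (a w : ℝ) :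
    ∫ z, (a + w * ((1 / (n : ℝ)) * ∑ i, F (z i) - ∫ u, F u ∂ν)) ^ 2
      ∂(Measure.pi fun _ : Fin n => ν) ≤ a ^ 2 + w ^ 2 * (B ^ 2 / n) := by
  have hn : (0 : ℝ) < n := by exact_mod_cast n.pos
  set P := Measure.pi fun _ : Fin n => ν with hP
  set μ := ∫ u, F u ∂ν with hμ
  set Y : (Fin n → E) → ℝ := fun z => (1 / (n : ℝ)) * ∑ i, F (z i) with hY
  have hYm : Measurable Y := measurable_mean n hF
  have hYb : ∀ z, |Y z| ≤ B := abs_mean_le hB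
  have hμb : |μ| ≤ B := abs_integral_le hB
  have hYi : Integrable Y P := integrable_of_abs_le hYm hYb
  have hFi : ∀ i : Fin n, Integrable (fun z : Fin n → E => F (z i)) P := fun i =>
    integrable_of_abs_le (hF.comp (measurable_pi_apply i)) fun z => hB (z i)
  have hmean : ∫ z, Y z ∂P = μ := by
    simp only [hY]
    rw [integral_const_mul, integral_finsetSum _ fun i _ => hFi i]
    have : ∀ i : Fin n, ∫ z, F (z i) ∂P = μ := fun i =>
      integral_comp_eval (μ := fun _ : Fin n => ν) (i := i) hF.aestronglyMeasurable
    simp only [this, Finset.sum_const, Finset.card_univ, Fintype.card_fin, nsmul_eq_mul]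
    field_simp
  have hvar : ∫ z, (Y z - μ) ^ 2 ∂P ≤ B ^ 2 / n := by
    have h1 : Var[Y; P] = ∫ z, (Y z - μ) ^ 2 ∂P := by
      rw [variance_eq_integral hYm.aemeasurable, hmean]
    have hL : MemLp F 2 ν := MemLp.of_bound hF.aestronglyMeasurable B
      (ae_of_all _ fun u => by simpa using hB u)
    have h2 : Var[Y; P] = (1 / (n : ℝ)) ^ 2 * ∑ _i : Fin n, Var[F; ν] := by
      rw [← variance_sum_pi (μ := fun _ : Fin n => ν) (X := fun _ => F) fun _ => hL,
        ← variance_const_mul]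
      congr 1
      ext z
      simp [hY]
    have h3 : Var[F; ν] ≤ B ^ 2 := by
      have := variance_le_sq_of_bounded (μ := ν) (a := -B) (b := B)
        (ae_of_all _ fun u => abs_le.1 (hB u)) hF.aemeasurable
      calc _ ≤ _ := this
        _ = B ^ 2 := by ring
    rw [← h1, h2]
    simp only [Finset.sum_const, Finset.card_univ, Fintype.card_fin, nsmul_eq_mul]
    calc (1 / (n : ℝ)) ^ 2 * (n * Var[F; ν]) = Var[F; ν] / n := by field_simp
      _ ≤ B ^ 2 / n := by gcongr
  have hi1 : Integrable (fun z => Y z - μ) P := hYi.sub (integrable_const _)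
  have hi2 : Integrable (fun z => (Y z - μ) ^ 2) P :=
    integrable_of_abs_le (by fun_prop) (B := (B + B) ^ 2) fun z => by
      rw [abs_pow]
      gcongr
      exact (abs_sub _ _).trans (add_le_add (hYb z) hμb)
  have hexp : ∀ z, (a + w * (Y z - μ)) ^ 2
      = a ^ 2 + 2 * a * w * (Y z - μ) + w ^ 2 * (Y z - μ) ^ 2 := fun z => by ring
  change ∫ z, (a + w * (Y z - μ)) ^ 2 ∂P ≤ _
  simp only [hexp]
  have hi3 : Integrable (fun z => a ^ 2 + 2 * a * w * (Y z - μ)) P :=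
    (integrable_const _).add (hi1.const_mul _)
  rw [integral_add hi3 (hi2.const_mul _),
    integral_add (integrable_const _) (hi1.const_mul _), integral_const_mul, integral_const_mul,
    integral_sub hYi (integrable_const _), hmean]
  simp only [integral_const, probReal_univ, smul_eq_mul, one_mul, sub_self, mul_zero, add_zero]
  gcongr

namespace Model

variable (m : Model E)

/-! ### One step of the particle system -/

instance isProbabilityMeasure_smcLaw (N : ℕ → ℕ+) : IsProbabilityMeasure (m.smcLaw N) := by
  unfold smcLaw; infer_instance

lemma map_eval_zero_smcLaw (N : ℕ → ℕ+) :
    (m.smcLaw N).map (fun x => x 0) = Measure.pi fun _ : Fin (N 0) => m.eta 0 := by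
  have h : (fun x : (l : ℕ) → Fin (N l) → E => x 0)
      = (fun y : (i : Finset.Iic 0) → Fin (N i) → E => y ⟨0, Finset.mem_Iic.2 le_rfl⟩) ∘
        Preorder.frestrictLe (π := fun l => Fin (N l) → E) 0 := rfl
  rw [h, ← Measure.map_map (by fun_prop) (by fun_prop), smcLaw, Kernel.trajMeasure,
    Measure.map_comp _ _ (by fun_prop), Kernel.traj_map_frestrictLe, Kernel.partialTraj_self,
    Measure.id_comp]
  exact (Measure.map_map (measurable_pi_apply _) (MeasurableEquiv.measurable _)).trans
    Measure.map_id

lemma measurable_etaN {N : ℕ → ℕ+} (l : ℕ) {f : E → ℝ} (hf : Measurable f) :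
    Measurable fun x : (l : ℕ) → Fin (N l) → E => etaN x l f := by
  unfold etaN; fun_prop

lemma measurable_gammaN {N : ℕ → ℕ+} (q : ℕ) {f : E → ℝ} (hf : Measurable f) :
    Measurable fun x : (l : ℕ) → Fin (N l) → E => m.gammaN x q f := by
  unfold gammaN
  exact (Finset.measurable_prod _ fun k _ => measurable_etaN k (m.measurable_G k)).mul
    (measurable_etaN q hf)

lemma integral_particleLaw (l : ℕ) {n : ℕ} (u : Fin n → E) {F : E → ℝ} (hF : Measurable F)
    {B : ℝ} (hB : ∀ u, |F u| ≤ B) :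
    ∫ v, F v ∂(m.particleLaw l u)
      = (∑ i, m.G l (u i))⁻¹ * ∑ i, m.G l (u i) * ∫ v, F v ∂(m.M (l + 1) (u i)) := by
  have := m.markov
  rw [particleLaw, integral_smul_measure, integral_finsetSum_measure]
  · rw [← ENNReal.ofReal_sum_of_nonneg fun i _ => (m.G_pos _ _).le, ENNReal.toReal_inv,
      ENNReal.toReal_ofReal (Finset.sum_nonneg fun i _ => (m.G_pos _ _).le), smul_eq_mul]
    congr 1
    refine Finset.sum_congr rfl fun i _ => ?_
    rw [integral_smul_measure, ENNReal.toReal_ofReal (m.G_pos _ _).le, smul_eq_mul]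
  · intro i _
    exact (integrable_of_abs_le hF hB).smul_measure ENNReal.ofReal_ne_top

/-- Resampling with the weights `G_l` and moving by `M_{l+1}` turns the empirical mean of
`G_l · M_{l+1}(F)` into the normalised one. -/
lemma etaN_G_mul_integral_particleLaw {N : ℕ → ℕ+} (x : (l : ℕ) → Fin (N l) → E) (l : ℕ)
    {F : E → ℝ} (hF : Measurable F) {B : ℝ} (hB : ∀ u, |F u| ≤ B) :
    etaN x l (m.G l) * ∫ v, F v ∂(m.particleLaw l (x l))
      = etaN x l fun u => m.G l u * ∫ v, F v ∂(m.M (l + 1) u) := by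
  rw [m.integral_particleLaw l (x l) hF hB, etaN, etaN]
  have : 0 < ∑ i, m.G l (x l i) :=
    Finset.sum_pos (fun i _ => m.G_pos _ _) ⟨⟨0, (N l).pos⟩, Finset.mem_univ _⟩
  field_simp

/-- The path that agrees with a given history up to level `k` and sits at an arbitrary point
afterwards. It turns functions of paths that depend on the first levels only into functions of
histories. -/
noncomputable def extendHistory [Nonempty E] (N : ℕ → ℕ+) (k : ℕ)
    (y : (i : Finset.Iic k) → Fin (N i) → E) : (l : ℕ) → Fin (N l) → E :=
  fun l => if hl : l ≤ k then y ⟨l, Finset.mem_Iic.2 hl⟩ else fun _ => Classical.arbitrary E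

lemma measurable_extendHistory [Nonempty E] (N : ℕ → ℕ+) (k : ℕ) :
    Measurable (extendHistory (E := E) N k) := by
  refine measurable_pi_lambda _ fun l => ?_
  unfold extendHistory
  by_cases hl : l ≤ k
  · simp only [hl, dif_pos]; exact measurable_pi_apply _
  · simp only [hl, dif_neg, not_false_eq_true]; exact measurable_const

omit [MeasurableSpace E] in
lemma extendHistory_apply [Nonempty E] {N : ℕ → ℕ+} {k l : ℕ} (hl : l ≤ k)
    (x : (l : ℕ) → Fin (N l) → E) :
    extendHistory N k (Preorder.frestrictLe (π := fun l => Fin (N l) → E) k x) l = x l := by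
  simp [extendHistory, hl]

/-- If `A` and `w` are functions of the first `k` levels, then the fluctuation of the particles of
level `k + 1` around their conditional law adds at most `W² B² / N_{k+1}` to the second moment. -/
lemma integral_sq_step_le [Nonempty E] {N : ℕ → ℕ+} (k : ℕ)
    {A w : ((l : ℕ) → Fin (N l) → E) → ℝ} (hA : Measurable A) (hw : Measurable w) {a W : ℝ}
    (ha : ∀ x, |A x| ≤ a) (hW : ∀ x, |w x| ≤ W)
    (hAk : DependsOn A (Set.Iic k)) (hwk : DependsOn w (Set.Iic k))
    {F : E → ℝ} (hF : Measurable F) {B : ℝ} (hB : ∀ u, |F u| ≤ B) :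
    ∫ x, (A x + w x * (etaN x (k + 1) F - ∫ v, F v ∂(m.particleLaw k (x k)))) ^ 2 ∂(m.smcLaw N)
      ≤ ∫ x, A x ^ 2 ∂(m.smcLaw N) + W ^ 2 * (B ^ 2 / N (k + 1)) := by
  set P := m.smcLaw N with hP
  set e := extendHistory (E := E) N k with he
  have hem : Measurable e := measurable_extendHistory N k
  set r := Preorder.frestrictLe (π := fun l => Fin (N l) → E) k with hr
  have hrm : Measurable r := by fun_prop
  have hAe : ∀ x, A (e (r x)) = A x := fun x => hAk fun l hl => extendHistory_apply hl x
  have hwe : ∀ x, w (e (r x)) = w x := fun x => hwk fun l hl => extendHistory_apply hl x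
  have hxe : ∀ x, e (r x) k = x k := fun x => extendHistory_apply le_rfl x
  have hee : ∀ y, e y k = y ⟨k, Finset.mem_Iic.2 le_rfl⟩ := fun y => by
    simp [he, extendHistory]
  have hpr : ∀ u : Fin (N k) → E, IsProbabilityMeasure (m.particleLaw k u) :=
    m.isProbabilityMeasure_particleLaw k (N k).pos
  have hnorm : ∀ u : Fin (N k) → E, |∫ v, F v ∂(m.particleLaw k u)| ≤ B := fun u =>
    abs_integral_le hB
  have hpm : Measurable fun u : Fin (N k) → E => ∫ v, F v ∂(m.particleLaw k u) := by
    let κ : Kernel (Fin (N k) → E) E := ⟨fun u => m.particleLaw k u, m.measurable_particleLaw k _⟩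
    have : IsMarkovKernel κ := ⟨hpr⟩
    exact (hF.stronglyMeasurable.integral_kernel (κ := κ)).measurable
  set φ : ((i : Finset.Iic k) → Fin (N i) → E) × (Fin (N (k + 1)) → E) → ℝ := fun p =>
    (A (e p.1) + w (e p.1) * ((1 / (N (k + 1) : ℝ)) * ∑ i, F (p.2 i)
      - ∫ v, F v ∂(m.particleLaw k (e p.1 k)))) ^ 2 with hφ
  have hφm : Measurable φ := by
    have h1 : Measurable fun p : ((i : Finset.Iic k) → Fin (N i) → E) × (Fin (N (k + 1)) → E) =>
        ∫ v, F v ∂(m.particleLaw k (e p.1 k)) :=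
      hpm.comp ((measurable_pi_apply k).comp (hem.comp measurable_fst))
    have h2 := (measurable_mean (N (k + 1)) hF).comp
      (measurable_snd : Measurable fun p : ((i : Finset.Iic k) → Fin (N i) → E) ×
        (Fin (N (k + 1)) → E) => p.2)
    exact ((hA.comp (hem.comp measurable_fst)).add ((hw.comp (hem.comp measurable_fst)).mul
      (h2.sub h1))).pow_const 2
  have hφb : ∀ p, |φ p| ≤ (a + W * (B + B)) ^ 2 := fun p => by
    rw [hφ, abs_pow]
    have hW0 : 0 ≤ W := (abs_nonneg _).trans (hW (e p.1))
    refine pow_le_pow_left₀ (abs_nonneg _) ((abs_add_le _ _).trans (add_le_add (ha _) ?_)) 2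
    rw [abs_mul]
    exact mul_le_mul (hW _) ((abs_sub _ _).trans (add_le_add (abs_mean_le hB _) (hnorm _)))
      (abs_nonneg _) hW0
  have hlaw : P.map r ⊗ₘ m.historyKernel N k = P.map fun x => (r x, x (k + 1)) :=
    Kernel.map_frestrictLe_trajMeasure_compProd_eq_map_trajMeasure
  have hprob : IsProbabilityMeasure (P.map r) := Measure.isProbabilityMeasure_map hrm.aemeasurable
  have hA2 : Measurable fun y => A (e y) ^ 2 := (hA.comp hem).pow_const 2
  have hA2b : ∀ y, |A (e y) ^ 2| ≤ a ^ 2 := fun y => by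
    rw [abs_pow]; exact pow_le_pow_left₀ (abs_nonneg _) (ha _) 2
  calc ∫ x, (A x + w x * (etaN x (k + 1) F - ∫ v, F v ∂(m.particleLaw k (x k)))) ^ 2 ∂P
      = ∫ x, φ (r x, x (k + 1)) ∂P := by
        refine integral_congr_ae (ae_of_all _ fun x => ?_)
        simp only [hφ, hAe, hwe, hxe]
        rfl
    _ = ∫ p, φ p ∂(P.map r ⊗ₘ m.historyKernel N k) := by
        rw [hlaw, integral_map (by fun_prop) hφm.aestronglyMeasurable]
    _ = ∫ y, ∫ z, φ (y, z) ∂(m.historyKernel N k y) ∂(P.map r) :=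
        Measure.integral_compProd (integrable_of_abs_le hφm hφb)
    _ ≤ ∫ y, (A (e y) ^ 2 + W ^ 2 * (B ^ 2 / N (k + 1))) ∂(P.map r) := by
        refine integral_mono_of_nonneg
          (ae_of_all _ fun y => integral_nonneg fun z => sq_nonneg _)
          ((integrable_of_abs_le hA2 hA2b).add (integrable_const _))
          (ae_of_all _ fun y => ?_)
        have hk : m.historyKernel N k y
            = Measure.pi fun _ : Fin (N (k + 1)) => m.particleLaw k (e y k) := by
          rw [hee]; rfl
        simp only [hk, hφ]
        refine (integral_sq_add_mul_mean_sub_le (N (k + 1)) hF hB _ _).trans ?_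
        gcongr _ + ?_ * _
        rw [← sq_abs]
        exact pow_le_pow_left₀ (abs_nonneg _) (hW _) 2
    _ = ∫ y, A (e y) ^ 2 ∂(P.map r) + W ^ 2 * (B ^ 2 / N (k + 1)) := by
        rw [integral_add (integrable_of_abs_le hA2 hA2b) (integrable_const _)]
        simp
    _ = ∫ x, A x ^ 2 ∂P + W ^ 2 * (B ^ 2 / N (k + 1)) := by
        rw [integral_map hrm.aemeasurable hA2.aestronglyMeasurable]
        simp only [hAe]

/-! ### The martingale bound for sums of Feynman-Kac averages -/

/-- The value function of the sum `∑_q γ_q(f_q)`: starting from the state `u` at level `k`, the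
Feynman-Kac expectation of `f_k + ⋯ + f_{k+n-1}`, each `f_q` being weighted by
`G_k(u_k) ⋯ G_{q-1}(u_{q-1})`. -/
noncomputable def valueFn (f : ℕ → E → ℝ) : ℕ → ℕ → E → ℝ
  | 0, _, _ => 0
  | n + 1, k, u => f k u + m.G k u * ∫ v, valueFn f n (k + 1) v ∂(m.M (k + 1) u)

lemma measurable_valueFn {f : ℕ → E → ℝ} (hf : ∀ k, Measurable (f k)) (n k : ℕ) :
    Measurable (m.valueFn f n k) := by
  have := m.markov
  induction n generalizing k with
  | zero => exact measurable_const
  | succ n ih =>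
    exact (hf k).add ((m.measurable_G k).mul
      ((ih (k + 1)).stronglyMeasurable.integral_kernel (κ := m.M (k + 1))).measurable)

lemma gammaN_add {N : ℕ → ℕ+} (x : (l : ℕ) → Fin (N l) → E) (q : ℕ) (f g : E → ℝ) :
    m.gammaN x q (fun u => f u + g u) = m.gammaN x q f + m.gammaN x q g := by
  simp only [gammaN, etaN, Finset.sum_add_distrib]; ring

lemma gammaN_valueFn_zero {N : ℕ → ℕ+} (x : (l : ℕ) → Fin (N l) → E) (f : ℕ → E → ℝ) (q : ℕ) :
    m.gammaN x q (m.valueFn f 0 q) = 0 := by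
  simp [gammaN, etaN, valueFn]

lemma dependsOn_prod_etaN {N : ℕ → ℕ+} {k n : ℕ} (hn : n ≤ k + 1) :
    DependsOn (fun x : (l : ℕ) → Fin (N l) → E => ∏ j ∈ Finset.range n, etaN x j (m.G j))
      (Set.Iic k) := by
  intro x y hxy
  refine Finset.prod_congr rfl fun j hj => ?_
  have : j ≤ k := by have := Finset.mem_range.1 hj; omega
  simp only [etaN, hxy j this]

lemma dependsOn_gammaN {N : ℕ → ℕ+} {k q : ℕ} (hq : q ≤ k) (f : E → ℝ) :
    DependsOn (fun x : (l : ℕ) → Fin (N l) → E => m.gammaN x q f) (Set.Iic k) := by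
  intro x y hxy
  have h1 := m.dependsOn_prod_etaN (N := N) (k := k) (n := q) (by omega) hxy
  simp only [gammaN, etaN] at h1 ⊢
  rw [h1, hxy q hq]

lemma abs_gammaN_le {N : ℕ → ℕ+} {W : ℝ} {x : (l : ℕ) → Fin (N l) → E} {q : ℕ}
    (hW : |∏ j ∈ Finset.range q, etaN x j (m.G j)| ≤ W) {f : E → ℝ} {B : ℝ}
    (hB : ∀ u, |f u| ≤ B) : |m.gammaN x q f| ≤ W * B := by
  rw [gammaN, abs_mul]
  exact mul_le_mul hW (abs_mean_le hB _) (abs_nonneg _) ((abs_nonneg _).trans hW)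

/-- The process `S_k = ∑_{j<k} γ_j^N(f_j) + γ_k^N(V_k)`, with `V_k` the value function of the
remaining terms, is a martingale with mean `η_0(V_0)`; its increments are bounded level by level. -/
lemma integral_sq_partialSum_sub_le [Nonempty E] (N : ℕ → ℕ+) {f : ℕ → E → ℝ}
    (hf : ∀ k, Measurable (f k)) {B : ℕ → ℝ} (hB : ∀ n k u, |m.valueFn f n k u| ≤ B k)
    {W : ℝ} (hW : ∀ k (x : (l : ℕ) → Fin (N l) → E),
      |∏ j ∈ Finset.range k, etaN x j (m.G j)| ≤ W) (k n : ℕ) :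
    ∫ x, (∑ j ∈ Finset.range k, m.gammaN x j (f j) + m.gammaN x k (m.valueFn f n k)
        - ∫ u, m.valueFn f (n + k) 0 u ∂(m.eta 0)) ^ 2 ∂(m.smcLaw N)
      ≤ W ^ 2 * ∑ j ∈ Finset.range (k + 1), B j ^ 2 / N j := by
  have hfB : ∀ k u, |f k u| ≤ B k := fun k u => by
    simpa [valueFn] using hB 1 k u
  have hW1 : 1 ≤ W := by
    simpa using hW 0 fun l => fun _ => Classical.arbitrary E
  induction k generalizing n with
  | zero =>
    have hF := m.measurable_valueFn hf n 0
    have h := integral_sq_add_mul_mean_sub_le (ν := m.eta 0) (N 0) hF (hB n 0) 0 1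
    have hint : ∫ x, (∑ j ∈ Finset.range 0, m.gammaN x j (f j) + m.gammaN x 0 (m.valueFn f n 0)
        - ∫ u, m.valueFn f (n + 0) 0 u ∂(m.eta 0)) ^ 2 ∂(m.smcLaw N)
        = ∫ z, (0 + 1 * ((1 / (N 0 : ℝ)) * ∑ i, m.valueFn f n 0 (z i)
          - ∫ u, m.valueFn f n 0 u ∂(m.eta 0))) ^ 2
          ∂(Measure.pi fun _ : Fin (N 0) => m.eta 0) := by
      rw [← m.map_eval_zero_smcLaw N, integral_map (measurable_pi_apply 0).aemeasurable]
      · simp [gammaN, etaN]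
      · refine Measurable.aestronglyMeasurable ?_
        have := measurable_mean (N 0) hF
        fun_prop
    rw [hint]
    refine h.trans ?_
    simp only [zero_add, Finset.range_one, Finset.sum_singleton]
    have h0 : 0 ≤ B 0 ^ 2 / (N 0 : ℝ) := by positivity
    calc (0 : ℝ) ^ 2 + 1 ^ 2 * (B 0 ^ 2 / (N 0 : ℝ)) = 1 * (B 0 ^ 2 / (N 0 : ℝ)) := by ring
      _ ≤ W ^ 2 * (B 0 ^ 2 / (N 0 : ℝ)) := by gcongr; exact one_le_pow₀ hW1
  | succ k ih =>
    set F := m.valueFn f n (k + 1) with hFdef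
    have hF : Measurable F := m.measurable_valueFn hf n (k + 1)
    set c := ∫ u, m.valueFn f (n + (k + 1)) 0 u ∂(m.eta 0) with hc
    set A : ((l : ℕ) → Fin (N l) → E) → ℝ := fun x =>
      ∑ j ∈ Finset.range k, m.gammaN x j (f j) + m.gammaN x k (m.valueFn f (n + 1) k) - c with hA
    set w : ((l : ℕ) → Fin (N l) → E) → ℝ := fun x =>
      ∏ j ∈ Finset.range (k + 1), etaN x j (m.G j) with hw
    -- the increment of the martingale
    have hstep : ∀ x : (l : ℕ) → Fin (N l) → E,
        ∑ j ∈ Finset.range (k + 1), m.gammaN x j (f j) + m.gammaN x (k + 1) F - c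
          = A x + w x * (etaN x (k + 1) F - ∫ v, F v ∂(m.particleLaw k (x k))) := by
      intro x
      have h1 : m.gammaN x k (m.valueFn f (n + 1) k) = m.gammaN x k (f k)
          + (∏ j ∈ Finset.range k, etaN x j (m.G j)) *
            (etaN x k (m.G k) * ∫ v, F v ∂(m.particleLaw k (x k))) := by
        rw [m.etaN_G_mul_integral_particleLaw x k hF (hB n (k + 1))]
        exact m.gammaN_add x k _ _
      simp only [hA, hw]
      rw [h1]
      simp only [Finset.sum_range_succ, gammaN, Finset.prod_range_succ]
      ring
    simp only [hstep]
    have hAm : Measurable A :=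
      ((Finset.measurable_sum _ fun j _ => m.measurable_gammaN j (hf j)).add
        (m.measurable_gammaN k (m.measurable_valueFn hf _ _))).sub_const _
    have hwm : Measurable w :=
      Finset.measurable_prod _ fun j _ => measurable_etaN j (m.measurable_G j)
    have hAb : ∀ x, |A x| ≤ ∑ j ∈ Finset.range k, W * B j + W * B k + |c| := fun x => by
      refine (abs_sub _ _).trans (add_le_add ((abs_add_le _ _).trans (add_le_add ?_ ?_)) le_rfl)
      · exact (Finset.abs_sum_le_sum_abs _ _).trans
          (Finset.sum_le_sum fun j _ => m.abs_gammaN_le (hW j x) (hfB j))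
      · exact m.abs_gammaN_le (hW k x) (hB _ k)
    have hAd : DependsOn A (Set.Iic k) := by
      intro x y hxy
      have h1 := m.dependsOn_gammaN (N := N) le_rfl (m.valueFn f (n + 1) k) hxy
      simp only [hA] at h1 ⊢
      rw [h1]
      congr 2
      refine Finset.sum_congr rfl fun j hj => ?_
      exact m.dependsOn_gammaN (Finset.mem_range.1 hj).le _ hxy
    refine (m.integral_sq_step_le k hAm hwm hAb (hW (k + 1)) hAd
      (m.dependsOn_prod_etaN le_rfl) hF (hB n (k + 1))).trans ?_
    have h2 := ih (n + 1)
    rw [show n + 1 + k = n + (k + 1) by ring] at h2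
    rw [Finset.sum_range_succ, mul_add]
    exact add_le_add h2 le_rfl

/-! ### The Feynman-Kac measures -/

lemma integral_eta (l : ℕ) (g : E → ℝ) :
    ∫ u, g u ∂(m.eta l) = (∫ u, m.kappa l u * g u ∂m.base) / m.Z l := by
  rw [eta, targetMeasure, integral_withDensity_eq_integral_toReal_smul
    ((m.kappa_measurable l).div_const _).ennreal_ofReal (ae_of_all _ fun _ => ENNReal.ofReal_lt_top),
    ← integral_div]
  refine integral_congr_ae (ae_of_all _ fun u => ?_)
  have : 0 ≤ m.kappa l u / partitionFn m.base (m.kappa l) :=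
    div_nonneg (m.kappa_pos l u).le (m.Z_pos l).le
  simp only [ENNReal.toReal_ofReal this, smul_eq_mul, Z]
  ring

lemma withDensity_eta (l : ℕ) :
    (m.eta l).withDensity (fun u => ENNReal.ofReal (m.G l u))
      = ENNReal.ofReal (m.Z (l + 1) / m.Z l) • m.eta (l + 1) := by
  have hm : ∀ l, Measurable fun u => ENNReal.ofReal (m.kappa l u / partitionFn m.base (m.kappa l)) :=
    fun l => ((m.kappa_measurable l).div_const _).ennreal_ofReal
  rw [eta, eta, targetMeasure, targetMeasure, ← withDensity_mul _ (hm l)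
    (m.measurable_G l).ennreal_ofReal, ← withDensity_smul _ (hm (l + 1))]
  congr 1
  ext u
  have h0 := m.Z_pos l
  have h1 := m.Z_pos (l + 1)
  have hk := m.kappa_pos l u
  simp only [Pi.mul_apply, Pi.smul_apply, smul_eq_mul]
  have h0' : 0 < partitionFn m.base (m.kappa l) := h0
  rw [← ENNReal.ofReal_mul (div_nonneg hk.le h0'.le), ← ENNReal.ofReal_mul (div_nonneg h1.le h0.le)]
  congr 1
  simp only [G, Z] at *
  field_simp

lemma gamma_eq (l : ℕ) : m.gamma l = ENNReal.ofReal (m.Z l / m.Z 0) • m.eta l := by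
  induction l with
  | zero => simp [gamma, (m.Z_pos 0).ne']
  | succ l ih =>
    have hinv : (m.eta (l + 1)).bind (m.M (l + 1)) = m.eta (l + 1) := m.invariant (l + 1) (by omega)
    rw [gamma, ih, withDensity_smul_measure, withDensity_eta, smul_smul, Measure.bind_smul, hinv,
      ← ENNReal.ofReal_mul (div_nonneg (m.Z_pos _).le (m.Z_pos _).le)]
    congr 2
    have := m.Z_pos l
    field_simp

lemma gammaOne_eq (l : ℕ) : m.gammaOne l = m.Z l / m.Z 0 := by
  rw [gammaOne, gamma_eq, measureReal_ennreal_smul_apply]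
  simp [div_nonneg (m.Z_pos l).le (m.Z_pos 0).le]

lemma integral_gamma (l : ℕ) (g : E → ℝ) :
    ∫ u, g u ∂(m.gamma l) = (∫ u, m.kappa l u * g u ∂m.base) / m.Z 0 := by
  have h0 := m.Z_pos l
  rw [gamma_eq, integral_smul_measure, integral_eta,
    ENNReal.toReal_ofReal (div_nonneg (m.Z_pos _).le (m.Z_pos _).le), smul_eq_mul]
  field_simp

instance isFiniteMeasure_gamma (l : ℕ) : IsFiniteMeasure (m.gamma l) := by
  rw [gamma_eq]
  exact Measure.smul_finite _ ENNReal.ofReal_ne_top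

lemma integral_gamma_G_mul_integral_M (l : ℕ) {g : E → ℝ} (hg : Measurable g) {B : ℝ}
    (hB : ∀ u, |g u| ≤ B) :
    ∫ u, m.G l u * ∫ v, g v ∂(m.M (l + 1) u) ∂(m.gamma l) = ∫ u, g u ∂(m.gamma (l + 1)) := by
  have := m.markov
  have hw : (m.gamma l).withDensity (fun u => ENNReal.ofReal (m.G l u))
      = ENNReal.ofReal (m.Z (l + 1) / m.Z 0) • m.eta (l + 1) := by
    rw [gamma_eq, withDensity_smul_measure, withDensity_eta, smul_smul,
      ← ENNReal.ofReal_mul (div_nonneg (m.Z_pos _).le (m.Z_pos _).le)]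
    congr 2
    have := m.Z_pos l
    field_simp
  set μ := (m.gamma l).withDensity fun u => ENNReal.ofReal (m.G l u) with hμ
  have hfin : IsFiniteMeasure μ := by rw [hw]; exact Measure.smul_finite _ ENNReal.ofReal_ne_top
  have h1 : ∫ u, g u ∂(m.gamma (l + 1)) = ∫ u, ∫ v, g v ∂(m.M (l + 1) u) ∂μ := by
    rw [gamma, ← hμ, ← Measure.snd_compProd, Measure.snd,
      integral_map measurable_snd.aemeasurable hg.aestronglyMeasurable]
    exact Measure.integral_compProd
      (integrable_of_abs_le (hg.comp measurable_snd) fun p => hB p.2)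
  rw [h1, hμ, integral_withDensity_eq_integral_toReal_smul (m.measurable_G l).ennreal_ofReal
    (ae_of_all _ fun _ => ENNReal.ofReal_lt_top)]
  simp only [ENNReal.toReal_ofReal (m.G_pos _ _).le, smul_eq_mul]

lemma integral_valueFn {f : ℕ → E → ℝ} (hf : ∀ k, Measurable (f k)) {B : ℕ → ℝ}
    (hB : ∀ n k u, |m.valueFn f n k u| ≤ B k) (n k : ℕ) :
    ∫ u, m.valueFn f n k u ∂(m.gamma k)
      = ∑ j ∈ Finset.range n, ∫ u, f (k + j) u ∂(m.gamma (k + j)) := by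
  have := m.markov
  induction n generalizing k with
  | zero => simp [valueFn]
  | succ n ih =>
    have hfB : ∀ k u, |f k u| ≤ B k := fun k u => by simpa [valueFn] using hB 1 k u
    have h1 : Integrable (f k) (m.gamma k) := integrable_of_abs_le (hf k) (hfB k)
    have h2 : Integrable (fun u => m.valueFn f (n + 1) k u) (m.gamma k) :=
      integrable_of_abs_le (m.measurable_valueFn hf _ _) (hB _ _)
    have h3 : Integrable (fun u => m.G k u * ∫ v, m.valueFn f n (k + 1) v ∂(m.M (k + 1) u))
        (m.gamma k) := by
      refine (h2.sub h1).congr (ae_of_all _ fun u => ?_)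
      simp [valueFn]
    simp only [valueFn]
    rw [integral_add h1 h3, m.integral_gamma_G_mul_integral_M k (m.measurable_valueFn hf _ _)
      (hB n (k + 1)), ih, Finset.sum_range_succ']
    simp only [add_zero, add_comm, add_left_comm]

/-! ### The mean square error of the new estimator -/

/-- The terms of the new estimator, `f_q = G_q (G_{q+1} - 1)`, where `f_0 = G_0 G_1` also absorbs
the leading term `η_0^{N_0}(G_0)`. -/
noncomputable def incrementFn : ℕ → E → ℝ
  | 0 => fun u => m.G 0 u + m.G 0 u * (m.G 1 u - 1)
  | q + 1 => fun u => m.G (q + 1) u * (m.G (q + 2) u - 1)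

lemma measurable_incrementFn (q : ℕ) : Measurable (m.incrementFn q) := by
  have h := m.measurable_G
  cases q with
  | zero => exact (h 0).add ((h 0).mul ((h 1).sub_const _))
  | succ q => exact (h _).mul ((h _).sub_const _)

lemma newEstimator_eq_sum {N : ℕ → ℕ+} (x : (l : ℕ) → Fin (N l) → E) (n : ℕ) :
    m.newEstimator (n + 2) x = ∑ q ∈ Finset.range (n + 1), m.gammaN x q (m.incrementFn q) := by
  have h : ∑ p ∈ Finset.Icc 2 (n + 2), m.gammaN x (p - 2)
        (fun u => m.G (p - 2) u * (m.G (p - 1) u - 1))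
      = ∑ q ∈ Finset.range (n + 1), m.gammaN x q (fun u => m.G q u * (m.G (q + 1) u - 1)) := by
    rw [← Finset.Ico_add_one_right_eq_Icc, Finset.sum_Ico_eq_sum_range]
    refine Finset.sum_congr (by congr 1) fun q _ => ?_
    rw [show 2 + q - 2 = q by omega, show 2 + q - 1 = q + 1 by omega]
  rw [newEstimator, h, Finset.sum_range_succ', Finset.sum_range_succ' _ n]
  have h0 : m.gammaN x 0 (m.incrementFn 0) = etaN x 0 (m.G 0)
      + m.gammaN x 0 (fun u => m.G 0 u * (m.G 1 u - 1)) := by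
    rw [incrementFn, gammaN_add]
    simp [gammaN]
  rw [h0]
  simp only [incrementFn, zero_add]
  ring

lemma integral_incrementFn_zero : ∫ u, m.incrementFn 0 u ∂(m.gamma 0) = m.gammaOne 2 := by
  rw [integral_gamma, gammaOne_eq, Z, partitionFn]
  congr 1
  refine integral_congr_ae (ae_of_all _ fun u => ?_)
  have h0 := m.kappa_pos 0 u
  have h1 := m.kappa_pos 1 u
  simp only [incrementFn, G, zero_add]
  field_simp
  ring

lemma integral_incrementFn_succ (q : ℕ) :
    ∫ u, m.incrementFn (q + 1) u ∂(m.gamma (q + 1)) = m.gammaOne (q + 3) - m.gammaOne (q + 2) := by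
  have hsub : m.Z (q + 3) - m.Z (q + 2)
      = ∫ u, (m.kappa (q + 3) u - m.kappa (q + 2) u) ∂m.base :=
    (integral_sub (m.kappa_integrable _) (m.kappa_integrable _)).symm
  rw [integral_gamma, gammaOne_eq, gammaOne_eq, ← sub_div, hsub]
  congr 1
  refine integral_congr_ae (ae_of_all _ fun u => ?_)
  have h0 := m.kappa_pos (q + 1) u
  have h1 := m.kappa_pos (q + 2) u
  simp only [incrementFn, G]
  field_simp

lemma sum_integral_incrementFn (n : ℕ) :
    ∑ q ∈ Finset.range (n + 1), ∫ u, m.incrementFn q u ∂(m.gamma q) = m.gammaOne (n + 2) := by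
  induction n with
  | zero => simpa using m.integral_incrementFn_zero
  | succ n ih => rw [Finset.sum_range_succ, ih, integral_incrementFn_succ]; ring

section Bounds

variable {m} {c r : ℝ}

lemma abs_G_le (hG : ∀ l u, |m.G l u - 1| ≤ c * r ^ l) (l : ℕ) (u : E) :
    |m.G l u| ≤ 1 + c * r ^ l := by
  have := abs_add_le (m.G l u - 1) 1
  simp only [sub_add_cancel, abs_one] at this
  linarith [hG l u]

lemma abs_incrementFn_le (hc : 0 ≤ c) (hr : 0 ≤ r) (hr1 : r ≤ 1)
    (hG : ∀ l u, |m.G l u - 1| ≤ c * r ^ l) (q : ℕ) (u : E) :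
    |m.incrementFn q u| ≤ (1 + c) ^ 2 * r ^ q := by
  have hG1 : ∀ l, |m.G l u| ≤ 1 + c := fun l =>
    (abs_G_le hG l u).trans (by
      have := mul_le_of_le_one_right hc (pow_le_one₀ hr hr1 (n := l))
      linarith)
  cases q with
  | zero =>
    have : m.incrementFn 0 u = m.G 0 u * m.G 1 u := by simp only [incrementFn]; ring
    rw [this, abs_mul, pow_zero, mul_one, sq]
    exact mul_le_mul (hG1 0) (hG1 1) (abs_nonneg _) (by positivity)
  | succ q =>
    simp only [incrementFn]
    rw [abs_mul, sq, mul_assoc]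
    refine mul_le_mul (hG1 _) ((hG _ u).trans ?_) (abs_nonneg _) (by positivity)
    exact mul_le_mul (by linarith) (pow_le_pow_of_le_one hr hr1 (by omega)) (by positivity)
      (by positivity)

/-- Since the weights `G_l` tend to `1` geometrically, their products stay bounded, and the value
functions inherit the geometric decay of their terms. -/
lemma abs_valueFn_le (hc : 0 ≤ c) (hr : 0 ≤ r) (hr1 : r < 1)
    (hG : ∀ l u, |m.G l u - 1| ≤ c * r ^ l) {f : ℕ → E → ℝ} {D : ℝ} (hD : 0 ≤ D)
    (hf : ∀ q u, |f q u| ≤ D * r ^ q) (n k : ℕ) (u : E) :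
    |m.valueFn f n k u| ≤ D * r ^ k / (1 - r) * Real.exp (c * r ^ k / (1 - r)) := by
  have := m.markov
  have h1r : 0 < 1 - r := by linarith
  induction n generalizing k u with
  | zero => simp only [valueFn, abs_zero]; positivity
  | succ n ih =>
    set e := Real.exp (c * r ^ (k + 1) / (1 - r)) with he
    have hexp : Real.exp (c * r ^ k / (1 - r)) = Real.exp (c * r ^ k) * e := by
      rw [he, ← Real.exp_add]
      congr 1
      field_simp
      ring
    have hint : |∫ v, m.valueFn f n (k + 1) v ∂(m.M (k + 1) u)|
        ≤ D * r ^ (k + 1) / (1 - r) * e := abs_integral_le fun v => ih (k + 1) v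
    have hGe : |m.G k u| ≤ Real.exp (c * r ^ k) :=
      (abs_G_le hG k u).trans (by linarith [Real.add_one_le_exp (c * r ^ k)])
    have h1 : 1 ≤ Real.exp (c * r ^ k) * e := by
      rw [← hexp]; exact Real.one_le_exp (by positivity)
    have hDk : 0 ≤ D * r ^ k := by positivity
    calc |m.valueFn f (n + 1) k u|
        ≤ |f k u| + |m.G k u * ∫ v, m.valueFn f n (k + 1) v ∂(m.M (k + 1) u)| := abs_add_le _ _
      _ ≤ D * r ^ k * (Real.exp (c * r ^ k) * e)
          + Real.exp (c * r ^ k) * (D * r ^ (k + 1) / (1 - r) * e) := by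
          rw [abs_mul]
          exact add_le_add ((hf k u).trans (le_mul_of_one_le_right hDk h1))
            (mul_le_mul hGe hint (abs_nonneg _) (Real.exp_pos _).le)
      _ = D * r ^ k / (1 - r) * Real.exp (c * r ^ k / (1 - r)) := by
          rw [hexp, pow_succ]
          field_simp
          ring

lemma abs_prod_etaN_le (hc : 0 ≤ c) (hr : 0 ≤ r) (hr1 : r < 1)
    (hG : ∀ l u, |m.G l u - 1| ≤ c * r ^ l) {N : ℕ → ℕ+} (k : ℕ)
    (x : (l : ℕ) → Fin (N l) → E) :
    |∏ j ∈ Finset.range k, etaN x j (m.G j)| ≤ Real.exp (c / (1 - r)) := by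
  rw [Finset.abs_prod]
  calc ∏ j ∈ Finset.range k, |etaN x j (m.G j)|
      ≤ ∏ j ∈ Finset.range k, Real.exp (c * r ^ j) := by
        refine Finset.prod_le_prod (fun _ _ => abs_nonneg _) fun j _ => ?_
        exact (abs_mean_le (abs_G_le hG j) _).trans
          (by linarith [Real.add_one_le_exp (c * r ^ j)])
    _ = Real.exp (c * ∑ j ∈ Finset.range k, r ^ j) := by
        rw [← Real.exp_sum, Finset.mul_sum]
    _ ≤ Real.exp (c / (1 - r)) := by
        have hsum : ∑ j ∈ Finset.range k, r ^ j ≤ (1 - r)⁻¹ := by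
          rw [← tsum_geometric_of_lt_one hr hr1]
          exact (summable_geometric_of_lt_one hr hr1).sum_le_tsum _ fun _ _ => by positivity
        rw [div_eq_mul_inv]
        gcongr

lemma nonempty_space (m : Model E) : Nonempty E := by
  by_contra h
  have := not_nonempty_iff.1 h
  exact m.base_ne_zero (Measure.eq_zero_of_isEmpty _)

lemma gammaInf_pos (m : Model E) : 0 < m.gammaInf := div_pos m.partitionFn_kappaInf_pos (m.Z_pos 0)

/-- If the weights tend to `1` at the geometric rate `r^l`, the mean square error of the new
estimator is, up to a constant, at most `∑_{j<L} r^{2j} / N_j` plus the squared relative bias. -/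
lemma exists_mse_le (hc : 0 ≤ c) (hr : 0 ≤ r) (hr1 : r < 1)
    (hG : ∀ l u, |m.G l u - 1| ≤ c * r ^ l) :
    ∃ K : ℝ, 0 < K ∧ ∀ (L : ℕ) (N : ℕ → ℕ+), 2 ≤ L →
      Integrable (fun x => (m.newEstimator L x - m.gammaInf) ^ 2) (m.smcLaw N) ∧
      1 / m.gammaInf ^ 2 * ∫ x, (m.newEstimator L x - m.gammaInf) ^ 2 ∂(m.smcLaw N)
        ≤ K * ∑ j ∈ Finset.range L, (r ^ 2) ^ j / N j
          + 2 * (m.gammaOne L / m.gammaInf - 1) ^ 2 := by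
  have := m.nonempty_space
  have hγ := m.gammaInf_pos
  have h1r : 0 < 1 - r := by linarith
  set W := Real.exp (c / (1 - r)) with hW
  set D := (1 + c) ^ 2 with hD
  have hD0 : 0 < D := by positivity
  set B := D / (1 - r) * W with hB
  have hB0 : 0 < B := by positivity
  have hf := abs_incrementFn_le hc hr hr1.le hG
  have hv : ∀ n k u, |m.valueFn m.incrementFn n k u| ≤ B * r ^ k := fun n k u => by
    refine (abs_valueFn_le hc hr hr1 hG hD0.le hf n k u).trans ?_
    have : Real.exp (c * r ^ k / (1 - r)) ≤ W :=
      Real.exp_le_exp.2 (by gcongr; exact mul_le_of_le_one_right hc (pow_le_one₀ hr hr1.le))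
    calc D * r ^ k / (1 - r) * Real.exp (c * r ^ k / (1 - r)) ≤ D * r ^ k / (1 - r) * W := by gcongr
      _ = B * r ^ k := by rw [hB]; ring
  refine ⟨2 / m.gammaInf ^ 2 * (W ^ 2 * B ^ 2), by positivity, fun L N hL => ?_⟩
  obtain ⟨n, rfl⟩ : ∃ n, L = n + 2 := ⟨L - 2, by omega⟩
  have hprod := fun k (x : (l : ℕ) → Fin (N l) → E) => abs_prod_etaN_le hc hr hr1 hG k x
  have hmeas : Measurable fun x : (l : ℕ) → Fin (N l) → E => m.newEstimator (n + 2) x := by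
    simp only [newEstimator_eq_sum]
    exact Finset.measurable_sum _ fun q _ => m.measurable_gammaN q (m.measurable_incrementFn q)
  set S := ∑ q ∈ Finset.range (n + 1), W * (D * r ^ q) with hS
  have hbdd : ∀ x : (l : ℕ) → Fin (N l) → E, |m.newEstimator (n + 2) x| ≤ S := fun x => by
    rw [newEstimator_eq_sum]
    exact (Finset.abs_sum_le_sum_abs _ _).trans
      (Finset.sum_le_sum fun q _ => m.abs_gammaN_le (hprod q x) (hf q))
  have hint : ∀ a : ℝ, Integrable (fun x => (m.newEstimator (n + 2) x - a) ^ 2) (m.smcLaw N) :=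
    fun a => integrable_of_abs_le ((hmeas.sub_const _).pow_const 2) (B := (S + |a|) ^ 2) fun x => by
      rw [abs_pow]
      exact pow_le_pow_left₀ (abs_nonneg _) ((abs_sub _ _).trans (add_le_add (hbdd x) le_rfl)) 2
  have hmean : ∫ u, m.valueFn m.incrementFn (0 + (n + 1)) 0 u ∂(m.eta 0) = m.gammaOne (n + 2) := by
    have := m.integral_valueFn m.measurable_incrementFn hv (n + 1) 0
    simp only [zero_add] at this ⊢
    rw [m.sum_integral_incrementFn n] at this
    exact this
  have hvar : ∫ x, (m.newEstimator (n + 2) x - m.gammaOne (n + 2)) ^ 2 ∂(m.smcLaw N)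
      ≤ W ^ 2 * B ^ 2 * ∑ j ∈ Finset.range (n + 2), (r ^ 2) ^ j / N j := by
    have := m.integral_sq_partialSum_sub_le N m.measurable_incrementFn hv hprod (n + 1) 0
    rw [hmean] at this
    simp only [gammaN_valueFn_zero, add_zero, ← newEstimator_eq_sum] at this
    refine this.trans_eq ?_
    rw [mul_assoc, Finset.mul_sum _ _ (B ^ 2)]
    congr 1
    refine Finset.sum_congr rfl fun j _ => ?_
    ring
  refine ⟨hint _, ?_⟩
  have hsplit : ∫ x, (m.newEstimator (n + 2) x - m.gammaInf) ^ 2 ∂(m.smcLaw N)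
      ≤ 2 * ∫ x, (m.newEstimator (n + 2) x - m.gammaOne (n + 2)) ^ 2 ∂(m.smcLaw N)
        + 2 * (m.gammaOne (n + 2) - m.gammaInf) ^ 2 := by
    calc _ ≤ ∫ x, (2 * (m.newEstimator (n + 2) x - m.gammaOne (n + 2)) ^ 2
          + 2 * (m.gammaOne (n + 2) - m.gammaInf) ^ 2) ∂(m.smcLaw N) := by
          refine integral_mono (hint _) (((hint _).const_mul 2).add (integrable_const _)) fun x => ?_
          have := sq_nonneg (m.newEstimator (n + 2) x - m.gammaOne (n + 2)
            - (m.gammaOne (n + 2) - m.gammaInf))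
          simp only
          linarith
      _ = _ := by
          rw [integral_add ((hint _).const_mul 2) (integrable_const _), integral_const_mul]
          simp
  calc _ ≤ 1 / m.gammaInf ^ 2 * (2 * (W ^ 2 * B ^ 2 * ∑ j ∈ Finset.range (n + 2), (r ^ 2) ^ j / N j)
        + 2 * (m.gammaOne (n + 2) - m.gammaInf) ^ 2) := by
        gcongr
        exact hsplit.trans (by gcongr)
    _ = _ := by field_simp

end Bounds

/-- The weight rate, together with the boundedness of the densities (which makes the supremum a
true one), gives a pointwise geometric bound. -/
lemma exists_abs_G_sub_one_le {h : ℕ → ℝ} {b β : ℝ} (hb : 1 < b) (hh0 : 0 < h 0)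
    (hh : ∀ l : ℕ, h l = h 0 * b ^ (-(l : ℝ))) (hβ : 0 < β) (hA1 : m.BoundedDensities)
    (hA3 : m.WeightRate h β) :
    ∃ c : ℝ, 0 ≤ c ∧ ∀ l u, |m.G l u - 1| ≤ c * (b ^ (-(β / 2))) ^ l := by
  obtain ⟨cLow, cUp, hlow, -, hκ⟩ := hA1
  obtain ⟨C, hC, hrate⟩ := hA3
  have hb0 : 0 < b := by linarith
  set r := b ^ (-(β / 2)) with hr
  have hr0 : 0 < r := Real.rpow_pos_of_pos hb0 _
  have hr1 : r ≤ 1 := Real.rpow_le_one_of_one_le_of_nonpos hb.le (by linarith)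
  refine ⟨Real.sqrt (C * h 0 ^ β), Real.sqrt_nonneg _, fun l u => ?_⟩
  have hbdd : BddAbove (Set.range fun u => |m.G (l + 1 - 1) u - 1|) := by
    refine ⟨cUp / cLow + 1, ?_⟩
    rintro _ ⟨v, rfl⟩
    refine (abs_sub _ _).trans (add_le_add ?_ (by simp))
    rw [abs_of_pos (m.G_pos _ _)]
    exact div_le_div₀ ((m.kappa_pos 0 v).le.trans (hκ 0 v).2) (hκ _ v).2 hlow (hκ _ v).1
  have h1 : |m.G l u - 1| ≤ ⨆ u, |m.G (l + 1 - 1) u - 1| := le_ciSup hbdd u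
  have hpow : h (l + 1) ^ β = h 0 ^ β * (r ^ (l + 1)) ^ 2 := by
    rw [hh, Real.mul_rpow hh0.le (Real.rpow_pos_of_pos hb0 _).le, ← Real.rpow_mul hb0.le, hr,
      ← Real.rpow_natCast, ← Real.rpow_natCast, ← Real.rpow_mul hb0.le, ← Real.rpow_mul hb0.le]
    congr 2
    push_cast
    ring
  have h2 : |m.G l u - 1| ^ 2 ≤ (Real.sqrt (C * h 0 ^ β) * r ^ (l + 1)) ^ 2 := by
    rw [mul_pow, Real.sq_sqrt (by positivity), mul_assoc, ← hpow]
    exact (pow_le_pow_left₀ (abs_nonneg _) h1 2).trans (hrate (l + 1) (by omega))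
  refine (le_of_sq_le_sq h2 (by positivity)).trans ?_
  gcongr ?_ * ?_
  exact pow_le_pow_of_le_one hr0.le hr1 (by omega)

end Model

/-! ### Choice of the level and of the particle numbers -/

/-- The optimal allocation for per-level variances `(s g)^l` and costs `z^l` with `z s = g`: taking
`N_l` proportional to `s^l = √(variance / cost)` makes variance and cost per level both
proportional to `g^l`. Rounding up adds one particle per level, hence the term `∑ z^l`. -/
lemma exists_allocation {s g z ε : ℝ} (hs : 0 < s) (hs1 : s ≤ 1) (hg : 0 < g) (hz : 1 < z)
    (hzs : z * s = g) (hε : 0 < ε) (L : ℕ) :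
    ∃ N : ℕ → ℕ+, Antitone N ∧
      ∑ l ∈ Finset.range (L + 1), (s * g) ^ l / N l ≤ ε ^ 2 ∧
      ∑ l ∈ Finset.range (L + 1), (N l : ℝ) * z ^ l
        ≤ (ε ^ 2)⁻¹ * (∑ l ∈ Finset.range (L + 1), g ^ l) ^ 2 + z ^ L * (z / (z - 1)) := by
  set K := ∑ l ∈ Finset.range (L + 1), g ^ l with hK
  have hK0 : 0 < K := Finset.sum_pos (fun l _ => by positivity) ⟨0, by simp⟩
  set a : ℕ → ℝ := fun l => (ε ^ 2)⁻¹ * K * s ^ l with ha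
  have ha0 : ∀ l, 0 < a l := fun l => by positivity
  have hN : ∀ l, 0 < ⌈a l⌉₊ := fun l => Nat.ceil_pos.2 (ha0 l)
  refine ⟨fun l => Nat.toPNat ⌈a l⌉₊ (hN l), fun i j hij => ?_, ?_, ?_⟩
  · refine (PNat.coe_le_coe _ _).1 (Nat.ceil_le_ceil ?_)
    simp only [ha]
    gcongr ?_ * ?_
    exact pow_le_pow_of_le_one hs.le hs1 hij
  · calc ∑ l ∈ Finset.range (L + 1), (s * g) ^ l / (⌈a l⌉₊ : ℝ)
        ≤ ∑ l ∈ Finset.range (L + 1), (ε ^ 2 / K) * g ^ l := by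
          refine Finset.sum_le_sum fun l _ => ?_
          calc (s * g) ^ l / (⌈a l⌉₊ : ℝ) ≤ (s * g) ^ l / a l := by
                gcongr
                exact Nat.le_ceil _
            _ = (ε ^ 2 / K) * g ^ l := by
                simp only [ha, mul_pow]
                field_simp
      _ = ε ^ 2 := by
          rw [← Finset.mul_sum, ← hK]
          field_simp
  · have hgeom : ∑ l ∈ Finset.range (L + 1), z ^ l ≤ z ^ L * (z / (z - 1)) := by
      have h1 : 0 < z - 1 := by linarith
      rw [geom_sum_eq hz.ne', ← mul_div_assoc, ← pow_succ]
      gcongr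
      linarith
    calc ∑ l ∈ Finset.range (L + 1), (⌈a l⌉₊ : ℝ) * z ^ l
        ≤ ∑ l ∈ Finset.range (L + 1), ((ε ^ 2)⁻¹ * K * g ^ l + z ^ l) := by
          refine Finset.sum_le_sum fun l _ => ?_
          calc (⌈a l⌉₊ : ℝ) * z ^ l ≤ (a l + 1) * z ^ l := by
                gcongr
                exact (Nat.ceil_lt_add_one (ha0 l).le).le
            _ = (ε ^ 2)⁻¹ * K * g ^ l + z ^ l := by
                simp only [ha, ← hzs, mul_pow]
                ring
      _ ≤ (ε ^ 2)⁻¹ * K ^ 2 + z ^ L * (z / (z - 1)) := by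
          rw [Finset.sum_add_distrib, ← Finset.mul_sum, ← hK]
          refine add_le_add (le_of_eq (by ring)) hgeom

/-- The factor by which the cost exceeds `ε⁻²`. -/
noncomputable def costFactor (α β ζ ε : ℝ) : ℝ :=
  if β = ζ then |Real.log ε| ^ 3
  else if ζ < β then |Real.log ε|
  else ε ^ (-((ζ - β) / α)) * |Real.log ε|

/-- The accuracy `h_L^α ≈ ε` is reached at a level `L` of order `|log ε|`. -/
lemma exists_level {b α ε₀ : ℝ} (hb : 1 < b) (hα : 0 < α) (hε₀ : 0 < ε₀) (hε₀' : ε₀ < 1) :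
    ∃ c₁ c₂ : ℝ, 0 < c₁ ∧ 0 < c₂ ∧ ∀ ε : ℝ, 0 < ε → ε ≤ ε₀ → ∃ L : ℕ, 2 ≤ L ∧
      (L : ℝ) + 1 ≤ c₁ * |Real.log ε| ∧ b ^ (-(α * L)) ≤ ε ∧ b ^ (L : ℝ) ≤ c₂ * ε ^ (-(1 / α)) := by
  have hb0 : 0 < b := by linarith
  have hlb : 0 < Real.log b := Real.log_pos hb
  have hl0 : 0 < |Real.log ε₀| := abs_pos.2 (Real.log_neg hε₀ hε₀').ne
  refine ⟨1 / (α * Real.log b) + 4 / |Real.log ε₀|, b ^ (3 : ℝ), by positivity, by positivity,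
    fun ε hε hεle => ?_⟩
  have hlog : Real.log ε ≤ Real.log ε₀ := Real.log_le_log hε hεle
  have hlog0 : Real.log ε₀ < 0 := Real.log_neg hε₀ hε₀'
  have habs : |Real.log ε| = -Real.log ε := abs_of_neg (by linarith)
  have habs0 : |Real.log ε₀| = -Real.log ε₀ := abs_of_neg hlog0
  set t := |Real.log ε| / (α * Real.log b) with ht
  have ht0 : 0 ≤ t := by positivity
  have hceil := Nat.ceil_lt_add_one ht0
  have hle := Nat.le_ceil t
  have htlog : t * (α * Real.log b) = - Real.log ε := by
    rw [ht, div_mul_cancel₀ _ (by positivity), habs]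
  refine ⟨⌈t⌉₊ + 2, by omega, ?_, ?_, ?_⟩
  · have h4 : 4 ≤ 4 / |Real.log ε₀| * |Real.log ε| := by
      rw [div_mul_eq_mul_div, le_div_iff₀ hl0, habs, habs0]
      linarith
    push_cast
    rw [add_mul, one_div_mul_eq_div, ← ht]
    linarith
  · rw [← Real.log_le_log_iff (by positivity) hε, Real.log_rpow hb0]
    push_cast
    have : t * (α * Real.log b) ≤ ((⌈t⌉₊ : ℝ) + 2) * (α * Real.log b) := by
      gcongr
      linarith
    linarith
  · have hεt : ε ^ (-(1 / α)) = b ^ t := by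
      rw [Real.rpow_def_of_pos hε, Real.rpow_def_of_pos hb0, ← neg_eq_iff_eq_neg.2 htlog]
      congr 1
      field_simp
    rw [hεt, ← Real.rpow_add hb0]
    refine Real.rpow_le_rpow_of_exponent_le hb.le ?_
    push_cast
    linarith

/-- The square of `∑_{l ≤ L} g^l`, where `g = b^{(ζ-β)/2}`, is bounded by the cost factor. -/
lemma exists_sq_geom_sum_le {b α β ζ ε₀ : ℝ} (hb : 1 < b) (hα : 0 < α) (hε₀ : 0 < ε₀)
    (hε₀' : ε₀ < 1) {c₁ c₂ D : ℝ} (hc₁ : 0 < c₁) (hc₂ : 0 < c₂) (hD : 0 < D) :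
    ∃ C : ℝ, 0 < C ∧ ∀ (ε : ℝ) (L : ℕ), 0 < ε → ε ≤ ε₀ → (L : ℝ) + 1 ≤ c₁ * |Real.log ε| →
      b ^ (L : ℝ) ≤ c₂ * ε ^ (-(1 / α)) →
      (∑ l ∈ Finset.range (L + 1), (b ^ ((ζ - β) / 2)) ^ l) ^ 2 + D ≤ C * costFactor α β ζ ε := by
  have hb0 : 0 < b := by linarith
  have hlog0 : Real.log ε₀ < 0 := Real.log_neg hε₀ hε₀'
  set ℓ := |Real.log ε₀| with hℓ
  have hℓ0 : 0 < ℓ := abs_pos.2 hlog0.ne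
  have hmono : ∀ ε, 0 < ε → ε ≤ ε₀ → ℓ ≤ |Real.log ε| := fun ε h1 h2 => by
    have := Real.log_le_log h1 h2
    rw [hℓ, abs_of_neg hlog0, abs_of_neg (by linarith)]
    linarith
  set g := b ^ ((ζ - β) / 2) with hg
  have hg0 : 0 < g := Real.rpow_pos_of_pos hb0 _
  rcases lt_trichotomy β ζ with hlt | heq | hgt
  · have hg1 : 1 < g := Real.one_lt_rpow hb (by linarith)
    have hg1' : 0 < g - 1 := by linarith
    set e := (ζ - β) / α with he
    have he0 : 0 < e := div_pos (by linarith) hα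
    set A := (g / (g - 1)) ^ 2 * c₂ ^ (ζ - β) with hA
    have hA0 : 0 < A := by positivity
    refine ⟨(A + D) / ℓ, by positivity, fun ε L hε hεle hL1 hL2 => ?_⟩
    have hK : ∑ l ∈ Finset.range (L + 1), g ^ l ≤ g ^ L * (g / (g - 1)) := by
      rw [geom_sum_eq hg1.ne', ← mul_div_assoc, ← pow_succ]
      gcongr
      linarith
    have hgL : (g ^ L) ^ 2 ≤ c₂ ^ (ζ - β) * ε ^ (-e) := by
      have h1 : (g ^ L) ^ 2 = (b ^ (L : ℝ)) ^ (ζ - β) := by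
        rw [hg, ← Real.rpow_natCast, ← Real.rpow_natCast, ← Real.rpow_mul hb0.le,
          ← Real.rpow_mul hb0.le, ← Real.rpow_mul hb0.le]
        congr 1
        push_cast
        ring
      have h2 : ε ^ (-e) = (ε ^ (-(1 / α))) ^ (ζ - β) := by
        rw [← Real.rpow_mul hε.le, he]
        congr 1
        ring
      rw [h1, h2, ← Real.mul_rpow hc₂.le (by positivity)]
      exact Real.rpow_le_rpow (by positivity) hL2 (by linarith)
    have hε1 : 1 ≤ ε ^ (-e) :=
      Real.one_le_rpow_of_pos_of_le_one_of_nonpos hε (by linarith) (by linarith)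
    have hcf : costFactor α β ζ ε = ε ^ (-e) * |Real.log ε| := by
      rw [costFactor, if_neg hlt.ne, if_neg hlt.not_gt]
    have hK0 : 0 ≤ ∑ l ∈ Finset.range (L + 1), g ^ l := Finset.sum_nonneg fun _ _ => by positivity
    calc (∑ l ∈ Finset.range (L + 1), g ^ l) ^ 2 + D
        ≤ (g ^ L * (g / (g - 1))) ^ 2 + D := by gcongr
      _ = (g / (g - 1)) ^ 2 * (g ^ L) ^ 2 + D * 1 := by ring
      _ ≤ (g / (g - 1)) ^ 2 * (c₂ ^ (ζ - β) * ε ^ (-e)) + D * ε ^ (-e) := by gcongr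
      _ = (A + D) / ℓ * (ε ^ (-e) * ℓ) := by rw [hA]; field_simp
      _ ≤ (A + D) / ℓ * costFactor α β ζ ε := by
          rw [hcf]
          gcongr
          exact hmono ε hε hεle
  · refine ⟨c₁ ^ 2 / ℓ + D / ℓ ^ 3, by positivity, fun ε L hε hεle hL1 hL2 => ?_⟩
    have hg1 : g = 1 := by rw [hg, heq]; simp
    have hcf : costFactor α β ζ ε = |Real.log ε| ^ 3 := by rw [costFactor, if_pos heq]
    have hl := hmono ε hε hεle
    rw [hcf, hg1]
    simp only [one_pow, Finset.sum_const, Finset.card_range, nsmul_eq_mul, mul_one]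
    push_cast
    rw [add_mul]
    refine add_le_add ?_ ?_
    · calc ((L : ℝ) + 1) ^ 2 ≤ (c₁ * |Real.log ε|) ^ 2 := by gcongr
        _ = c₁ ^ 2 / ℓ * (|Real.log ε| ^ 2 * ℓ) := by field_simp
        _ ≤ c₁ ^ 2 / ℓ * (|Real.log ε| ^ 2 * |Real.log ε|) := by gcongr
        _ = _ := by ring
    · calc D = D / ℓ ^ 3 * ℓ ^ 3 := by field_simp
        _ ≤ _ := by gcongr
  · have hg1 : g < 1 := Real.rpow_lt_one_of_one_lt_of_neg hb (by linarith)
    refine ⟨((1 - g)⁻¹ ^ 2 + D) / ℓ, by positivity, fun ε L hε hεle hL1 hL2 => ?_⟩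
    have hcf : costFactor α β ζ ε = |Real.log ε| := by
      rw [costFactor, if_neg hgt.ne', if_pos hgt]
    have hK : ∑ l ∈ Finset.range (L + 1), g ^ l ≤ (1 - g)⁻¹ := by
      rw [← tsum_geometric_of_lt_one hg0.le hg1]
      exact (summable_geometric_of_lt_one hg0.le hg1).sum_le_tsum _ fun _ _ => by positivity
    have hK0 : 0 ≤ ∑ l ∈ Finset.range (L + 1), g ^ l := Finset.sum_nonneg fun _ _ => by positivity
    calc (∑ l ∈ Finset.range (L + 1), g ^ l) ^ 2 + D ≤ (1 - g)⁻¹ ^ 2 + D := by gcongr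
      _ = ((1 - g)⁻¹ ^ 2 + D) / ℓ * ℓ := by field_simp
      _ ≤ _ := by
          rw [hcf]
          gcongr
          exact hmono ε hε hεle

end MLSMC

theorem mainTheorem4 {E : Type*} [MeasurableSpace E] (m : MLSMC.Model E)
    (h cost : ℕ → ℝ) (b α β ζ : ℝ)
    (hb : 1 < b) (hh0 : 0 < h 0) (hh : ∀ l : ℕ, h l = h 0 * b ^ (-(l : ℝ)))
    (hcost : ∀ l, 0 ≤ cost l)
    (hα : 0 < α) (hβ : 0 < β) (hζ : 0 < ζ)
    (hA1 : m.BoundedDensities) (hA2 : m.UniformMixing) (hA3i : m.BiasCostRate h cost α ζ) (hA3iii : m.WeightRate h β)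
    (hrate : max β ζ ≤ 2 * α)
    (ε₀ : ℝ) (hε₀ : 0 < ε₀) (hε₀' : ε₀ < 1) :
    ∃ C : ℝ, 0 < C ∧ ∀ ε : ℝ, 0 < ε → ε ≤ ε₀ →
      ∃ (L : ℕ) (N : ℕ → ℕ+), 2 ≤ L ∧ Antitone N ∧
        Integrable (fun x => (m.newEstimator L x - m.gammaInf) ^ 2) (m.smcLaw N) ∧
        1 / m.gammaInf ^ 2 * ∫ x, (m.newEstimator L x - m.gammaInf) ^ 2 ∂(m.smcLaw N)
          ≤ C * ε ^ 2 ∧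
        (ζ < β → MLSMC.totalCost cost N L ≤ C * (ε ^ (-2 : ℝ) * |Real.log ε|)) ∧
        (β = ζ → MLSMC.totalCost cost N L ≤ C * (ε ^ (-2 : ℝ) * |Real.log ε| ^ 3)) ∧
        (β < ζ → MLSMC.totalCost cost N L
          ≤ C * (ε ^ (-(2 + (ζ - β) / α)) * |Real.log ε|)) := by
  have hb0 : 0 < b := by linarith
  obtain ⟨c, hc, hG⟩ := m.exists_abs_G_sub_one_le hb hh0 hh hβ hA1 hA3iii
  have hr0 : 0 < b ^ (-(β / 2)) := Real.rpow_pos_of_pos hb0 _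
  have hr1 : b ^ (-(β / 2)) < 1 := Real.rpow_lt_one_of_one_lt_of_neg hb (by linarith)
  obtain ⟨K, hK, hmse⟩ := MLSMC.Model.exists_mse_le hc hr0.le hr1 hG
  obtain ⟨C₀, hC₀, hbias⟩ := hA3i
  obtain ⟨c₁, c₂, hc₁, hc₂, hlevel⟩ := MLSMC.exists_level hb hα hε₀ hε₀'
  set s := b ^ (-((β + ζ) / 2)) with hs
  set g := b ^ ((ζ - β) / 2) with hg
  set z := b ^ ζ with hz
  have hs0 : 0 < s := Real.rpow_pos_of_pos hb0 _
  have hs1 : s ≤ 1 := Real.rpow_le_one_of_one_le_of_nonpos hb.le (by linarith)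
  have hg0 : 0 < g := Real.rpow_pos_of_pos hb0 _
  have hz1 : 1 < z := Real.one_lt_rpow hb hζ
  have hz1' : 0 < z - 1 := by linarith
  have hzs : z * s = g := by
    rw [hz, hs, hg, ← Real.rpow_add hb0]; congr 1; ring
  have hsg : s * g = (b ^ (-(β / 2))) ^ 2 := by
    rw [hs, hg, ← Real.rpow_add hb0, ← Real.rpow_natCast, ← Real.rpow_mul hb0.le]
    congr 1; push_cast; ring
  set D := c₂ ^ ζ * (z / (z - 1)) with hD
  have hD0 : 0 < D := by positivity
  obtain ⟨C₁, hC₁, hgeom⟩ := MLSMC.exists_sq_geom_sum_le (β := β) (ζ := ζ) hb hα hε₀ hε₀'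
    hc₁ hc₂ hD0
  set Q := C₀ * h 0 ^ (-ζ) * (z + z ^ 2) with hQ
  have hQ0 : 0 < Q := by positivity
  set C := K + 2 * (C₀ * h 0 ^ α) ^ 2 + Q * C₁ with hC
  have hCQ : Q * C₁ ≤ C := by rw [hC]; linarith [sq_nonneg (C₀ * h 0 ^ α)]
  have hCK : K + 2 * (C₀ * h 0 ^ α) ^ 2 ≤ C := by rw [hC]; linarith [mul_pos hQ0 hC₁]
  refine ⟨C, by positivity, fun ε hε hεle => ?_⟩
  obtain ⟨L, hL2, hL1, hLb, hLc⟩ := hlevel ε hε hεle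
  obtain ⟨N, hN, hvar, hcostN⟩ := MLSMC.exists_allocation hs0 hs1 hg0 hz1 hzs hε L
  obtain ⟨hint, hmseL⟩ := hmse L N hL2
  have hε1 : ε < 1 := by linarith
  -- the cost of one evaluation, in terms of `z ^ l`
  have hcl : ∀ l, cost l ≤ C₀ * h 0 ^ (-ζ) * z * z ^ l := fun l => by
    have h1 := (hbias (l + 1) (by omega)).2
    rw [Nat.add_sub_cancel] at h1
    refine h1.trans_eq ?_
    rw [hh, Real.mul_rpow hh0.le (Real.rpow_pos_of_pos hb0 _).le, ← Real.rpow_mul hb0.le,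
      mul_assoc, mul_assoc, ← pow_succ', hz, ← Real.rpow_natCast, ← Real.rpow_mul hb0.le]
    congr 3
    push_cast
    ring
  have htot : MLSMC.totalCost cost N L ≤ Q * ∑ l ∈ Finset.range (L + 1), (N l : ℝ) * z ^ l := by
    rw [MLSMC.totalCost]
    have h1 : ∑ l ∈ Finset.range (L + 1), (N l : ℝ) * cost l
        ≤ C₀ * h 0 ^ (-ζ) * z * ∑ l ∈ Finset.range (L + 1), (N l : ℝ) * z ^ l := by
      rw [Finset.mul_sum]
      refine Finset.sum_le_sum fun l _ => ?_
      calc (N l : ℝ) * cost l ≤ (N l : ℝ) * (C₀ * h 0 ^ (-ζ) * z * z ^ l) := by gcongr; exact hcl l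
        _ = _ := by ring
    have h2 : ∑ l ∈ Finset.range (L - 1), (N l : ℝ) * cost (l + 1)
        ≤ C₀ * h 0 ^ (-ζ) * z ^ 2 * ∑ l ∈ Finset.range (L + 1), (N l : ℝ) * z ^ l := by
      calc ∑ l ∈ Finset.range (L - 1), (N l : ℝ) * cost (l + 1)
          ≤ ∑ l ∈ Finset.range (L + 1), (N l : ℝ) * cost (l + 1) :=
            Finset.sum_le_sum_of_subset_of_nonneg (Finset.range_mono (by omega))
              fun l _ _ => mul_nonneg (by positivity) (hcost _)
        _ ≤ _ := by
            rw [Finset.mul_sum]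
            refine Finset.sum_le_sum fun l _ => ?_
            calc (N l : ℝ) * cost (l + 1) ≤ (N l : ℝ) * (C₀ * h 0 ^ (-ζ) * z * z ^ (l + 1)) := by
                  gcongr; exact hcl _
              _ = _ := by ring
    refine (add_le_add h1 h2).trans_eq ?_
    rw [hQ]; ring
  -- rounding the particle numbers up costs `z ^ L`, which `ζ ≤ 2 α` makes at most of order `ε⁻²`
  have hzL : z ^ L ≤ c₂ ^ ζ * (ε ^ 2)⁻¹ := by
    have h1 : z ^ L = (b ^ (L : ℝ)) ^ ζ := by
      rw [hz, ← Real.rpow_natCast, ← Real.rpow_mul hb0.le, ← Real.rpow_mul hb0.le, mul_comm]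
    have h2 : (ε ^ (-(1 / α))) ^ ζ ≤ (ε ^ 2)⁻¹ := by
      rw [← Real.rpow_mul hε.le, ← Real.rpow_natCast, ← Real.rpow_neg hε.le]
      refine Real.rpow_le_rpow_of_exponent_ge hε hε1.le ?_
      have : ζ / α ≤ 2 := (div_le_iff₀ hα).2 ((le_max_right _ _).trans hrate)
      push_cast
      rw [neg_mul, one_div_mul_eq_div]
      linarith
    rw [h1]
    calc (b ^ (L : ℝ)) ^ ζ ≤ (c₂ * ε ^ (-(1 / α))) ^ ζ :=
          Real.rpow_le_rpow (by positivity) hLc hζ.le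
      _ = c₂ ^ ζ * (ε ^ (-(1 / α))) ^ ζ := Real.mul_rpow hc₂.le (by positivity)
      _ ≤ _ := by gcongr
  have hfin : MLSMC.totalCost cost N L ≤ C * ((ε ^ 2)⁻¹ * MLSMC.costFactor α β ζ ε) := by
    have hcf : 0 ≤ MLSMC.costFactor α β ζ ε := by
      rw [MLSMC.costFactor]; split_ifs <;> positivity
    calc MLSMC.totalCost cost N L
        ≤ Q * ((ε ^ 2)⁻¹ * (∑ l ∈ Finset.range (L + 1), g ^ l) ^ 2
            + (c₂ ^ ζ * (ε ^ 2)⁻¹) * (z / (z - 1))) := by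
          refine htot.trans ?_
          gcongr
          exact hcostN.trans (by gcongr)
      _ = Q * ((ε ^ 2)⁻¹ * ((∑ l ∈ Finset.range (L + 1), g ^ l) ^ 2 + D)) := by rw [hD]; ring
      _ ≤ Q * ((ε ^ 2)⁻¹ * (C₁ * MLSMC.costFactor α β ζ ε)) := by
          gcongr
          exact hgeom ε L hε hεle hL1 hLc
      _ = Q * C₁ * ((ε ^ 2)⁻¹ * MLSMC.costFactor α β ζ ε) := by ring
      _ ≤ _ := by gcongr
  have hε2 : ε ^ (-2 : ℝ) = (ε ^ 2)⁻¹ := by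
    rw [Real.rpow_neg hε.le]; norm_cast
  refine ⟨L, N, hL2, hN, hint, ?_, fun hlt => ?_, fun heq => ?_, fun hlt => ?_⟩
  · have hb2 : (m.gammaOne L / m.gammaInf - 1) ^ 2 ≤ (C₀ * h 0 ^ α) ^ 2 * ε ^ 2 := by
      have h1 := (hbias L (by omega)).1
      have h2 : h L ^ α ≤ h 0 ^ α * ε := by
        rw [hh, Real.mul_rpow hh0.le (Real.rpow_pos_of_pos hb0 _).le, ← Real.rpow_mul hb0.le]
        gcongr
        rwa [neg_mul, mul_comm]
      rw [← mul_pow, ← sq_abs]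
      refine pow_le_pow_left₀ (abs_nonneg _) (h1.trans ?_) 2
      rw [mul_assoc]
      gcongr
    have hv : ∑ j ∈ Finset.range L, ((b ^ (-(β / 2))) ^ 2) ^ j / N j ≤ ε ^ 2 := by
      rw [← hsg]
      exact (Finset.sum_le_sum_of_subset_of_nonneg (Finset.range_mono (by omega))
        fun l _ _ => by positivity).trans hvar
    calc _ ≤ _ := hmseL
      _ ≤ K * ε ^ 2 + 2 * ((C₀ * h 0 ^ α) ^ 2 * ε ^ 2) := by gcongr
      _ = (K + 2 * (C₀ * h 0 ^ α) ^ 2) * ε ^ 2 := by ring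
      _ ≤ C * ε ^ 2 := by gcongr
  · rwa [MLSMC.costFactor, if_neg hlt.ne', if_pos hlt, ← hε2] at hfin
  · rwa [MLSMC.costFactor, if_pos heq, ← hε2] at hfin
  · rw [MLSMC.costFactor, if_neg hlt.ne, if_neg hlt.not_gt, ← hε2,
      ← mul_assoc (ε ^ (-2 : ℝ)), ← Real.rpow_add hε, ← neg_add] at hfin
    exact hfin
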